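/- Let $\hbar>0$ and let $\mu$ be a probability measure on $\mathbb R$ (the momentum-kick distribution; the case of a probability density $\tilde g$ is $d\mu=\tilde g(p)\,dp$). Put $g(\xi)=\int_{\mathbb R} e^{\frac{i}{\hbar}p\xi}\,d\mu(p)$ and let $$\Delta_g(\rho)=\int_{\mathbb R} e^{\frac{i}{\hbar}p\hat X}\,\rho\,e^{-\frac{i}{\hbar}p\hat X}\,d\mu(p)$$ (integral in the strong operator topology) be the random-kick dephasing channel on bounded operators on $L^2(\mathbb R)$, where $e^{\frac{i}{\hbar}p\hat X}$ is multiplication by $e^{\frac{i}{\hbar}px}$. A normal state is a positive trace-class operator on $L^2(\mathbb R)$ of trace one. For a Hilbert--Schmidt operator $\rho$ with Hilbert--Schmidt norm $\|\rho\|_2$ let $$C_2^g(\rho)=\|\rho\|_2^2-\|\Delta_g(\rho)\|_2^2 .$$ Every normal state is Hilbert--Schmidt, and for every Hilbert--Schmidt operator $\rho$ on $L^2(\mathbb R)$ (in particular for every normal state) $\Delta_g(\rho)$ is Hilbert--Schmidt and $\rho$ has an integral kernel $\rho(x,y)\in L^2(\mathbb R^2)$. Moreover: 1. For every Hilbert--Schmidt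 $\rho$ and every kernel $\rho(x,y)\in L^2(\mathbb R^2)$ of $\rho$, the function $(1-|g(x-y)|^2)|\rho(x,y)|^2$ is integrable on $\mathbb R^2$ and $$C_2^g(\rho)=\iint_{\mathbb R^2}\bigl(1-|g(x-y)|^2\bigr)\,|\rho(x,y)|^2\,dx\,dy .$$ 2. If $\mu$ is not a point mass at some $p_0\neq 0$ (in particular if $\mu$ has a density, or has mean zero), then for every Hilbert--Schmidt $\rho$ $$C_2^g(\rho)=0\iff \Delta_g(\rho)=\rho .$$ 3. If $|g(\xi)|<1$ for all $\xi\neq 0$, then $C_2^g(\rho)>0$ for every normal state $\rho$. -/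

import Mathlib

open MeasureTheory
open scoped ENNReal

noncomputable section

/-- The Hilbert space `L²(ℝ)` of complex wavefunctions on the line. -/
abbrev L2R : Type := Lp ℂ 2 (volume : Measure ℝ)

/-! ### Hilbert-Schmidt norm, trace, normal states -/

/-- The index set of a fixed Hilbert basis of `L²(ℝ)`. -/
def l2Index : Set L2R := Classical.choose (exists_hilbertBasis ℂ L2R)

/-- A fixed Hilbert basis of `L²(ℝ)`. It only serves to write down traces and Hilbert-Schmidt
norms, which do not depend on it: see `hsNormSq_eq` and `posTrace_eq`. -/
def l2Basis : HilbertBasis l2Index ℂ L2R :=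
  Classical.choose (Classical.choose_spec (exists_hilbertBasis ℂ L2R))

/-- The squared Hilbert-Schmidt norm `‖T‖₂² = ∑ ‖T eᵢ‖²`, with values in `[0, ∞]`. -/
def hsNormSq (T : L2R →L[ℂ] L2R) : ℝ≥0∞ := ∑' i, ‖T (l2Basis i)‖ₑ ^ 2

/-- `T` is a Hilbert-Schmidt operator. -/
def IsHilbertSchmidt (T : L2R →L[ℂ] L2R) : Prop := hsNormSq T ≠ ∞

/-- The trace `∑ ⟨eᵢ, T eᵢ⟩` of a positive operator `T`, with values in `[0, ∞]`. -/
def posTrace (T : L2R →L[ℂ] L2R) : ℝ≥0∞ :=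
  ∑' i, ENNReal.ofReal (RCLike.re (inner ℂ (l2Basis i) (T (l2Basis i))))

/-- A normal state (density operator) on `L²(ℝ)`: a positive trace-class operator of trace one. -/
structure IsNormalState (ρ : L2R →L[ℂ] L2R) : Prop where
  isPositive : ρ.IsPositive
  trace_eq_one : posTrace ρ = 1

theorem enorm_sq_eq_tsum {ι : Type*} (b : HilbertBasis ι ℂ L2R) (v : L2R) :
    ‖v‖ₑ ^ 2 = ∑' i, ‖inner ℂ (b i) v‖ₑ ^ 2 := by
  have h := b.hasSum_inner_mul_inner v v
  have h2 : HasSum (fun i => ‖inner ℂ (b i) v‖ ^ 2) (‖v‖ ^ 2) := by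
    have h3 := RCLike.hasSum_re (𝕜 := ℂ) h
    rw [inner_self_eq_norm_sq] at h3
    refine h3.congr_fun ?_ |> fun h => h
    intro i
    rw [inner_mul_symm_re_eq_norm, norm_mul, norm_inner_symm v, sq]
  have e : ∀ w : ℝ, ∀ _ : 0 ≤ w, ENNReal.ofReal (w ^ 2) = (ENNReal.ofReal w) ^ 2 :=
    fun w hw => ENNReal.ofReal_pow hw 2
  rw [← ofReal_norm, ← e _ (norm_nonneg _), ← h2.tsum_eq,
    ENNReal.ofReal_tsum_of_nonneg (fun i => by positivity) h2.summable]
  refine tsum_congr fun i => ?_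
  rw [e _ (norm_nonneg _), ofReal_norm]

theorem tsum_enorm_sq_adjoint {ι κ : Type*} (b : HilbertBasis ι ℂ L2R)
    (c : HilbertBasis κ ℂ L2R) (T : L2R →L[ℂ] L2R) :
    ∑' i, ‖T (b i)‖ₑ ^ 2 = ∑' j, ‖ContinuousLinearMap.adjoint T (c j)‖ₑ ^ 2 := by
  simp_rw [fun i => enorm_sq_eq_tsum c (T (b i)),
    fun j => enorm_sq_eq_tsum b (ContinuousLinearMap.adjoint T (c j))]
  rw [ENNReal.tsum_comm]
  refine tsum_congr fun j => tsum_congr fun i => ?_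
  rw [ContinuousLinearMap.adjoint_inner_right, ← ofReal_norm, ← ofReal_norm, norm_inner_symm]

/-- The Hilbert-Schmidt norm does not depend on the Hilbert basis. -/
theorem hsNormSq_eq {ι : Type*} (b : HilbertBasis ι ℂ L2R) (T : L2R →L[ℂ] L2R) :
    hsNormSq T = ∑' i, ‖T (b i)‖ₑ ^ 2 := by
  rw [hsNormSq, tsum_enorm_sq_adjoint l2Basis l2Basis, ← tsum_enorm_sq_adjoint b l2Basis]

theorem exists_adjoint_eq_self_mul_self {H : Type*} [NormedAddCommGroup H]
    [InnerProductSpace ℂ H] [CompleteSpace H] (T : H →L[ℂ] H) (hT : T.IsPositive) :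
    ∃ S : H →L[ℂ] H, ContinuousLinearMap.adjoint S = S ∧ S * S = T := by
  have hT0 : 0 ≤ T := (ContinuousLinearMap.nonneg_iff_isPositive T).2 hT
  exact ⟨CFC.sqrt T, (IsSelfAdjoint.of_nonneg (CFC.sqrt_nonneg T)).star_eq,
    CFC.sqrt_mul_sqrt_self T⟩

/-- The trace of a positive operator does not depend on the Hilbert basis. -/
theorem posTrace_eq {ι : Type*} (b : HilbertBasis ι ℂ L2R) (T : L2R →L[ℂ] L2R)
    (hT : T.IsPositive) :
    posTrace T = ∑' i, ENNReal.ofReal (RCLike.re (inner ℂ (b i) (T (b i)))) := by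
  obtain ⟨S, hS, hSS⟩ := exists_adjoint_eq_self_mul_self T hT
  have key : ∀ v : L2R, ENNReal.ofReal (RCLike.re (inner ℂ v (T v))) = ‖S v‖ₑ ^ 2 := by
    intro v
    have : inner ℂ v (T v) = inner ℂ (S v) (S v) := by
      rw [← hSS, ← ContinuousLinearMap.adjoint_inner_right, hS]; rfl
    rw [this, inner_self_eq_norm_sq, ENNReal.ofReal_pow (norm_nonneg _), ofReal_norm]
  simp_rw [posTrace, key]
  exact hsNormSq_eq b S

/-- `k` is the position kernel `k(x, y) = ⟨x|T|y⟩` of the Hilbert-Schmidt operator `T`: it is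
square integrable on `ℝ²` and `(T f)(x) = ∫ k(x, y) f(y) dy`. -/
structure IsHSKernel (T : L2R →L[ℂ] L2R) (k : ℝ × ℝ → ℂ) : Prop where
  memLp : MemLp k 2 (volume : Measure (ℝ × ℝ))
  apply_ae : ∀ f : L2R, (T f : ℝ → ℂ) =ᵐ[volume] fun x => ∫ y, k (x, y) * f y

/-! ### The random-kick dephasing channel -/

/-- The phase `exp(i p x / ħ)`. -/
def kickPhase (ħ p x : ℝ) : ℂ := Complex.exp (((p * x / ħ : ℝ) : ℂ) * Complex.I)

theorem norm_kickPhase (ħ p x : ℝ) : ‖kickPhase ħ p x‖ = 1 := Complex.norm_exp_ofReal_mul_I _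

theorem continuous_kickPhase (ħ p : ℝ) : Continuous (kickPhase ħ p) := by
  unfold kickPhase; fun_prop

theorem continuous_kickPhase_left (ħ x : ℝ) : Continuous fun p => kickPhase ħ p x := by
  unfold kickPhase; fun_prop

theorem memLp_kickPhase_mul (ħ p : ℝ) (f : L2R) :
    MemLp (fun x => kickPhase ħ p x * f x) 2 (volume : Measure ℝ) :=
  (Lp.memLp f).of_le ((continuous_kickPhase ħ p).aestronglyMeasurable.mul
    (Lp.aestronglyMeasurable f)) (.of_forall fun x => by simp [norm_kickPhase])

theorem norm_kickPhase_mul_toLp (ħ p : ℝ) (f : L2R) :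
    ‖(memLp_kickPhase_mul ħ p f).toLp‖ = ‖f‖ := by
  rw [Lp.norm_toLp, Lp.norm_def]
  congr 1
  exact eLpNorm_congr_norm_ae (.of_forall fun x => by simp [norm_kickPhase])

/-- The momentum kick `exp(i p X / ħ)`, i.e. multiplication by `exp(i p x / ħ)`,
on `L²(ℝ)`. -/
def kick (ħ p : ℝ) : L2R →L[ℂ] L2R :=
  LinearMap.mkContinuous
    { toFun := fun f => (memLp_kickPhase_mul ħ p f).toLp
      map_add' := fun f h => by
        rw [← MemLp.toLp_add, MemLp.toLp_eq_toLp_iff]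
        filter_upwards [Lp.coeFn_add f h] with x hx
        rw [hx, Pi.add_apply, mul_add]
        rfl
      map_smul' := fun c f => by
        rw [RingHom.id_apply, ← MemLp.toLp_const_smul, MemLp.toLp_eq_toLp_iff]
        filter_upwards [Lp.coeFn_smul c f] with x hx
        simp only [hx, Pi.smul_apply, smul_eq_mul]
        ring }
    1 (fun f => by
      rw [one_mul]
      exact (norm_kickPhase_mul_toLp ħ p f).le)

theorem kick_apply (ħ p : ℝ) (f : L2R) : kick ħ p f = (memLp_kickPhase_mul ħ p f).toLp := rfl

theorem coeFn_kick (ħ p : ℝ) (f : L2R) :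
    (kick ħ p f : ℝ → ℂ) =ᵐ[volume] fun x => kickPhase ħ p x * f x := by
  rw [kick_apply]; exact MemLp.coeFn_toLp _

theorem norm_kick_apply (ħ p : ℝ) (f : L2R) : ‖kick ħ p f‖ = ‖f‖ := norm_kickPhase_mul_toLp ħ p f

theorem continuous_kick_apply (ħ : ℝ) (f : L2R) : Continuous fun p => kick ħ p f := by
  rw [continuous_iff_continuousAt]
  intro q
  have hint : Integrable (fun x => ‖f x‖ ^ 2) (volume : Measure ℝ) :=
    (Lp.memLp f).integrable_norm_pow (by norm_num)
  have h1 : Continuous fun p => inner ℂ (kick ħ q f) (kick ħ p f) := by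
    have : (fun p => inner ℂ (kick ħ q f) (kick ħ p f)) = fun p => ∫ x,
        inner ℂ (kickPhase ħ q x * f x) (kickPhase ħ p x * f x) := by
      funext p
      rw [L2.inner_def]
      refine integral_congr_ae ?_
      filter_upwards [coeFn_kick ħ q f, coeFn_kick ħ p f] with x h1 h2
      rw [h1, h2]
    rw [this]
    refine continuous_of_dominated (bound := fun x => ‖f x‖ ^ 2) ?_ ?_ hint ?_
    · intro p
      exact (memLp_kickPhase_mul ħ q f).1.inner (memLp_kickPhase_mul ħ p f).1
    · intro p
      refine .of_forall fun x => (norm_inner_le_norm _ _).trans ?_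
      simp [norm_kickPhase, sq]
    · refine .of_forall fun x => ?_
      exact continuous_const.inner ((continuous_kickPhase_left ħ x).mul continuous_const)
  have h2 : ∀ p, ‖kick ħ p f - kick ħ q f‖ ^ 2
      = 2 * ‖f‖ ^ 2 - 2 * RCLike.re (inner ℂ (kick ħ q f) (kick ħ p f)) := by
    intro p
    rw [norm_sub_rev, norm_sub_sq (𝕜 := ℂ), norm_kick_apply, norm_kick_apply]
    ring
  have h3 : Filter.Tendsto (fun p => ‖kick ħ p f - kick ħ q f‖ ^ 2) (nhds q) (nhds 0) := by
    have hc : Continuous fun p => ‖kick ħ p f - kick ħ q f‖ ^ 2 := by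
      simp_rw [h2]
      exact continuous_const.sub (continuous_const.mul (RCLike.continuous_re.comp h1))
    have := hc.tendsto q
    simpa using this
  rw [ContinuousAt, tendsto_iff_norm_sub_tendsto_zero]
  have h4 := h3.sqrt
  simpa [Real.sqrt_sq (norm_nonneg _)] using h4

theorem continuous_kick_conj (ħ : ℝ) (ρ : L2R →L[ℂ] L2R) (f : L2R) :
    Continuous fun p => kick ħ p (ρ (kick ħ (-p) f)) := by
  have hv : Continuous fun p => ρ (kick ħ (-p) f) :=
    ρ.continuous.comp ((continuous_kick_apply ħ f).comp continuous_neg)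
  rw [continuous_iff_continuousAt]
  intro q
  rw [ContinuousAt, tendsto_iff_norm_sub_tendsto_zero]
  have h1 := tendsto_iff_norm_sub_tendsto_zero.1 (hv.tendsto q)
  have h2 := tendsto_iff_norm_sub_tendsto_zero.1
    ((continuous_kick_apply ħ (ρ (kick ħ (-q) f))).tendsto q)
  refine squeeze_zero (fun _ => norm_nonneg _) (fun p => ?_) (by simpa using h1.add h2)
  calc _ = ‖kick ħ p (ρ (kick ħ (-p) f) - ρ (kick ħ (-q) f))
          + (kick ħ p (ρ (kick ħ (-q) f)) - kick ħ q (ρ (kick ħ (-q) f)))‖ := by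
        rw [map_sub]; congr 1; abel
    _ ≤ _ := (norm_add_le _ _).trans (by rw [norm_kick_apply])

theorem norm_kick_conj_le (ħ p : ℝ) (ρ : L2R →L[ℂ] L2R) (f : L2R) :
    ‖kick ħ p (ρ (kick ħ (-p) f))‖ ≤ ‖ρ‖ * ‖f‖ := by
  rw [norm_kick_apply]
  exact (ρ.le_opNorm _).trans (by rw [norm_kick_apply])

theorem integrable_kick_conj (ħ : ℝ) (μ : Measure ℝ) [IsProbabilityMeasure μ]
    (ρ : L2R →L[ℂ] L2R) (f : L2R) :
    Integrable (fun p => kick ħ p (ρ (kick ħ (-p) f))) μ :=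
  .of_bound (continuous_kick_conj ħ ρ f).aestronglyMeasurable (‖ρ‖ * ‖f‖)
    (.of_forall fun p => norm_kick_conj_le ħ p ρ f)

/-- The random-kick dephasing channel `Δ_g(ρ) = ∫ exp(i p X / ħ) ρ exp(-i p X / ħ) dμ(p)` with
momentum-kick distribution `μ`, for an arbitrary bounded operator `ρ`. The integral converges
in the strong operator topology. -/
def dephasing (ħ : ℝ) (μ : Measure ℝ) [IsProbabilityMeasure μ] (ρ : L2R →L[ℂ] L2R) :
    L2R →L[ℂ] L2R :=
  LinearMap.mkContinuous
    { toFun := fun f => ∫ p, kick ħ p (ρ (kick ħ (-p) f)) ∂μ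
      map_add' := fun f h => by
        simp only [map_add]
        exact integral_add (integrable_kick_conj ħ μ ρ f) (integrable_kick_conj ħ μ ρ h)
      map_smul' := fun c f => by
        simp only [map_smul, RingHom.id_apply]
        exact integral_smul c _ }
    ‖ρ‖ (fun f => by
      refine (norm_integral_le_of_norm_le_const
        (.of_forall fun p => norm_kick_conj_le ħ p ρ f)).trans ?_
      simp)

/-- The dephasing function `g(ξ) = ∫ exp(i p ξ / ħ) dμ(p)`. -/
def dephasingKernel (ħ : ℝ) (μ : Measure ℝ) (ξ : ℝ) : ℂ := ∫ p, kickPhase ħ p ξ ∂μ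

/-- A kick distribution with a probability density is not a point mass. -/
theorem ne_dirac_of_absolutelyContinuous (μ : Measure ℝ) (hμ : μ ≪ volume) (p : ℝ) :
    μ ≠ Measure.dirac p := by
  rintro rfl
  have h := hμ (Real.volume_singleton (a := p))
  simp at h

/-- The `l₂` dephasing loss `C₂^g(ρ) = ‖ρ‖₂² - ‖Δ_g(ρ)‖₂²`. -/
def l2DephasingLoss (ħ : ℝ) (μ : Measure ℝ) [IsProbabilityMeasure μ] (ρ : L2R →L[ℂ] L2R) : ℝ :=
  (hsNormSq ρ).toReal - (hsNormSq (dephasing ħ μ ρ)).toReal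

end

open scoped ComplexConjugate

/-!
An operator with square integrable kernel `k` has matrix elements
`⟨g, T f⟩ = ∬ k(x, y) conj(g(x)) f(y)`, and this determines `k` and `T` from each other. Parseval in
the variable `y`, applied to the sections `k(x, ·)`, identifies `‖T‖₂` with `‖k‖` in `L²(ℝ²)`; in
the other direction the kernel of a Hilbert-Schmidt operator is the orthogonal series
`∑ (T eᵢ)(x) conj(eᵢ(y))`.

Conjugation by `exp(i p X / ħ)` multiplies the kernel by `exp(i p (x - y) / ħ)`, so by Fubini
dephasing multiplies it by `g(x - y)`, which gives the integral formula. Its integrand is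
nonnegative and vanishes almost everywhere only if `|g(x - y)| = 1` for almost every `(x, y)` with
`k(x, y) ≠ 0`. If `|g(ξ)| = 1`, equality holds in the triangle inequality for the integral `g(ξ)`,
so the phase `p ↦ exp(i p ξ / ħ)` is constant on the support of `μ`. Two distinct points `p, q` of
the support then force `(p - q) ξ ∈ 2 π ħ ℤ`, a countable and hence null set of `ξ`. So either `μ`
is a point mass, or the loss vanishes only at `ρ = 0`.
-/

section HilbertSpace

variable {ι 𝕜 E : Type*} [RCLike 𝕜] [NormedAddCommGroup E] [InnerProductSpace 𝕜 E]

theorem countable_of_orthonormal [TopologicalSpace.SeparableSpace E] {v : ι → E}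
    (hv : Orthonormal 𝕜 v) : Countable ι := by
  refine Pairwise.countable_of_isOpen_disjoint (s := fun i => Metric.ball (v i) (1 / 2))
    (fun i j hij => Metric.ball_disjoint_ball ?_) (fun i => Metric.isOpen_ball)
    (fun i => ⟨v i, Metric.mem_ball_self (by norm_num)⟩)
  have hsq : ‖v i - v j‖ ^ 2 = 2 := by
    rw [norm_sub_sq (𝕜 := 𝕜), hv.2 hij, hv.1, hv.1, map_zero]
    norm_num
  rw [dist_eq_norm]
  nlinarith [norm_nonneg (v i - v j)]

theorem tsum_enorm_sq_inner_right (b : HilbertBasis ι 𝕜 E) (v : E) :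
    ∑' i, ‖inner 𝕜 v (b i)‖ₑ ^ 2 = ‖v‖ₑ ^ 2 := by
  have hsum : HasSum (fun i => ‖inner 𝕜 v (b i)‖ ^ 2) (‖v‖ ^ 2) := by
    simpa [norm_inner_symm v, b.repr_apply_apply] using
      lp.hasSum_norm (p := 2) (by norm_num) (b.repr v)
  simp_rw [← ofReal_norm, ← ENNReal.ofReal_pow (norm_nonneg _)]
  rw [← ENNReal.ofReal_tsum_of_nonneg (fun i => by positivity) hsum.summable, hsum.tsum_eq]

theorem summable_of_pairwise_inner_eq_zero [CompleteSpace E] {F : ι → E}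
    (hF : Pairwise fun i j => inner 𝕜 (F i) (F j) = 0) (hsq : Summable fun i => ‖F i‖ ^ 2) :
    Summable F := by
  have horth : OrthogonalFamily 𝕜 (fun i => Submodule.span 𝕜 {F i})
      fun i => (Submodule.span 𝕜 {F i}).subtypeₗᵢ := by
    refine OrthogonalFamily.of_pairwise fun i j hij => Submodule.isOrtho_span.2 ?_
    rintro _ rfl _ rfl
    exact hF hij
  exact (horth.summable_iff_norm_sq_summable
    fun i => ⟨F i, Submodule.mem_span_singleton_self _⟩).2 hsq

end HilbertSpace

section IntegralKernel

variable {α β ι 𝕜 E : Type*} [MeasurableSpace α] [MeasurableSpace β] {μ : Measure α}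
  {ν : Measure β} [RCLike 𝕜] [NormedAddCommGroup E]

theorem eLpNorm_two_sq (f : α → E) : eLpNorm f 2 μ ^ 2 = ∫⁻ x, ‖f x‖ₑ ^ 2 ∂μ := by
  simpa using eLpNorm_nnreal_pow_eq_lintegral (μ := μ) (f := f) (p := 2) two_ne_zero

theorem enorm_toLp_two_sq {f : α → E} (hf : MemLp f 2 μ) :
    ‖hf.toLp‖ₑ ^ 2 = ∫⁻ x, ‖f x‖ₑ ^ 2 ∂μ := by
  rw [Lp.enorm_toLp, eLpNorm_two_sq]

theorem ae_memLp_prodMk_left [SFinite ν] {p : ℝ≥0∞} (hp₀ : p ≠ 0) (hp : p ≠ ∞) {k : α × β → E}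
    (hk : MemLp k p (μ.prod ν)) : ∀ᵐ x ∂μ, MemLp (fun y => k (x, y)) p ν := by
  have hint := (integrable_norm_rpow_iff hk.1 hp₀ hp).2 hk
  filter_upwards [((integrable_prod_iff hint.1).1 hint).1, hk.1.prodMk_left] with x hx hmeas
  exact (integrable_norm_rpow_iff hmeas hp₀ hp).1 hx

theorem integral_mul_eq_inner_star {k : β → 𝕜} (hk : MemLp k 2 ν) (f : Lp 𝕜 2 ν) :
    ∫ y, k y * f y ∂ν = inner 𝕜 hk.star.toLp f := by
  rw [L2.inner_def]
  refine integral_congr_ae ?_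
  filter_upwards [hk.star.coeFn_toLp] with y hy
  simp [hy, RCLike.inner_apply, mul_comm]

theorem tsum_enorm_sq_integral_mul (b : HilbertBasis ι 𝕜 (Lp 𝕜 2 ν)) {k : β → 𝕜}
    (hk : MemLp k 2 ν) : ∑' i, ‖∫ y, k y * b i y ∂ν‖ₑ ^ 2 = ∫⁻ y, ‖k y‖ₑ ^ 2 ∂ν := by
  simp_rw [integral_mul_eq_inner_star hk]
  rw [tsum_enorm_sq_inner_right, enorm_toLp_two_sq]
  simp

theorem enorm_integral_mul_sq_le {k : β → 𝕜} (hk : MemLp k 2 ν) (f : Lp 𝕜 2 ν) :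
    ‖∫ y, k y * f y ∂ν‖ₑ ^ 2 ≤ (∫⁻ y, ‖k y‖ₑ ^ 2 ∂ν) * ‖f‖ₑ ^ 2 := by
  have hstar : ∫⁻ y, ‖k y‖ₑ ^ 2 ∂ν = ‖hk.star.toLp‖ₑ ^ 2 := by
    rw [enorm_toLp_two_sq]
    simp
  rw [hstar, integral_mul_eq_inner_star hk, ← mul_pow]
  gcongr
  simp_rw [← ofReal_norm, ← ENNReal.ofReal_mul (norm_nonneg _)]
  exact ENNReal.ofReal_le_ofReal (norm_inner_le_norm _ _)

theorem memLp_integral_mul [SFinite ν] {k : α × β → 𝕜} (hk : MemLp k 2 (μ.prod ν))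
    (f : Lp 𝕜 2 ν) : MemLp (fun x => ∫ y, k (x, y) * f y ∂ν) 2 μ := by
  refine ⟨(hk.1.mul (Lp.aestronglyMeasurable f).comp_snd).integral_prod_right', ?_⟩
  refine (ENNReal.pow_lt_top_iff (n := 2)).1 ?_ |>.resolve_right two_ne_zero
  calc eLpNorm (fun x => ∫ y, k (x, y) * f y ∂ν) 2 μ ^ 2
      = ∫⁻ x, ‖∫ y, k (x, y) * f y ∂ν‖ₑ ^ 2 ∂μ := eLpNorm_two_sq _
    _ ≤ ∫⁻ x, (∫⁻ y, ‖k (x, y)‖ₑ ^ 2 ∂ν) * ‖f‖ₑ ^ 2 ∂μ := by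
        refine lintegral_mono_ae ?_
        filter_upwards [ae_memLp_prodMk_left two_ne_zero ENNReal.ofNat_ne_top hk] with x hx
        exact enorm_integral_mul_sq_le hx f
    _ = eLpNorm k 2 (μ.prod ν) ^ 2 * ‖f‖ₑ ^ 2 := by
        rw [lintegral_mul_const' _ _ (by finiteness), eLpNorm_two_sq,
          lintegral_prod _ (hk.1.enorm.pow_const 2)]
    _ < ∞ := by have := hk.2; finiteness

theorem tsum_enorm_sq_eq_lintegral_kernel [SFinite ν] [Countable ι]
    (b : HilbertBasis ι 𝕜 (Lp 𝕜 2 ν)) {k : α × β → 𝕜} (hk : MemLp k 2 (μ.prod ν))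
    {u : ι → Lp 𝕜 2 μ} (hu : ∀ i, u i =ᵐ[μ] fun x => ∫ y, k (x, y) * b i y ∂ν) :
    ∑' i, ‖u i‖ₑ ^ 2 = ∫⁻ z, ‖k z‖ₑ ^ 2 ∂μ.prod ν := by
  simp_rw [Lp.enorm_def, eLpNorm_two_sq]
  rw [← lintegral_tsum fun i => (Lp.aestronglyMeasurable _).enorm.pow_const 2,
    lintegral_prod _ (hk.1.enorm.pow_const 2)]
  refine lintegral_congr_ae ?_
  filter_upwards [ae_all_iff.2 hu, ae_memLp_prodMk_left two_ne_zero ENNReal.ofNat_ne_top hk]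
    with x hux hkx
  simp_rw [hux]
  exact tsum_enorm_sq_integral_mul b hkx

theorem memLp_mul_conj_prod {g : α → 𝕜} {h : β → 𝕜} (hg : MemLp g 2 μ) (hh : MemLp h 2 ν) :
    MemLp (fun z : α × β => g z.1 * conj (h z.2)) 2 (μ.prod ν) := by
  refine (memLp_two_iff_integrable_sq_norm (hg.1.comp_fst.mul hh.star.1.comp_snd)).2 ?_
  simpa only [Pi.mul_apply, Pi.star_apply, norm_mul, norm_star, mul_pow] using
    (hg.integrable_norm_pow two_ne_zero).mul_prod (hh.integrable_norm_pow two_ne_zero)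

theorem integrable_kernel_mul {k : α × β → 𝕜} (hk : MemLp k 2 (μ.prod ν)) (g : Lp 𝕜 2 μ)
    (f : Lp 𝕜 2 ν) : Integrable (fun z => k z * (conj (g z.1) * f z.2)) (μ.prod ν) := by
  simpa [Pi.mul_def] using
    hk.integrable_mul (memLp_mul_conj_prod (Lp.memLp g) (Lp.memLp f)).star

/-- The element `(x, y) ↦ g(x) conj(h(y))` of `L²(μ ⊗ ν)`. It is the integral kernel of the rank
one operator `f ↦ ⟨h, f⟩ g`, i.e. of `InnerProductSpace.rankOne 𝕜 g h`. -/
noncomputable def rankOneKernel (g : Lp 𝕜 2 μ) (h : Lp 𝕜 2 ν) : Lp 𝕜 2 (μ.prod ν) :=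
  (memLp_mul_conj_prod (Lp.memLp g) (Lp.memLp h)).toLp

theorem coeFn_rankOneKernel (g : Lp 𝕜 2 μ) (h : Lp 𝕜 2 ν) :
    rankOneKernel g h =ᵐ[μ.prod ν] fun z => g z.1 * conj (h z.2) :=
  MemLp.coeFn_toLp _

theorem inner_rankOneKernel_left (g : Lp 𝕜 2 μ) (h : Lp 𝕜 2 ν) (k : Lp 𝕜 2 (μ.prod ν)) :
    inner 𝕜 (rankOneKernel g h) k = ∫ z, k z * (conj (g z.1) * h z.2) ∂μ.prod ν := by
  rw [L2.inner_def]
  refine integral_congr_ae ?_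
  filter_upwards [coeFn_rankOneKernel g h] with z hz
  simp [hz, RCLike.inner_apply]

theorem inner_eq_integral_conj_mul (g h : Lp 𝕜 2 μ) :
    inner 𝕜 g h = ∫ x, conj (g x) * h x ∂μ := by
  simp [L2.inner_def, RCLike.inner_apply, mul_comm]

variable [SFinite μ] [SFinite ν]

theorem inner_rankOneKernel_rankOneKernel (g g' : Lp 𝕜 2 μ) (h h' : Lp 𝕜 2 ν) :
    inner 𝕜 (rankOneKernel g h) (rankOneKernel g' h') = inner 𝕜 g g' * inner 𝕜 h' h := by
  rw [inner_rankOneKernel_left, inner_eq_integral_conj_mul, inner_eq_integral_conj_mul,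
    ← integral_prod_mul]
  refine integral_congr_ae ?_
  filter_upwards [coeFn_rankOneKernel g' h'] with z hz
  rw [hz]
  ring

theorem norm_rankOneKernel (g : Lp 𝕜 2 μ) (h : Lp 𝕜 2 ν) :
    ‖rankOneKernel g h‖ = ‖g‖ * ‖h‖ := by
  have hsq : ‖rankOneKernel g h‖ ^ 2 = (‖g‖ * ‖h‖) ^ 2 := by
    have := inner_rankOneKernel_rankOneKernel g g h h
    simp only [inner_self_eq_norm_sq_to_K] at this
    rw [mul_pow]
    exact_mod_cast this
  exact (pow_left_inj₀ (norm_nonneg _) (by positivity) two_ne_zero).1 hsq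

theorem ae_eq_integral_mul_iff {k : α × β → 𝕜} (hk : MemLp k 2 (μ.prod ν))
    (f : Lp 𝕜 2 ν) (u : Lp 𝕜 2 μ) :
    u =ᵐ[μ] (fun x => ∫ y, k (x, y) * f y ∂ν) ↔
      ∀ g : Lp 𝕜 2 μ, inner 𝕜 g u = ∫ z, k z * (conj (g z.1) * f z.2) ∂μ.prod ν := by
  have hKf := memLp_integral_mul hk f
  have hinner (g : Lp 𝕜 2 μ) :
      inner 𝕜 g hKf.toLp = ∫ z, k z * (conj (g z.1) * f z.2) ∂μ.prod ν := by
    rw [inner_eq_integral_conj_mul, integral_prod _ (integrable_kernel_mul hk g f)]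
    refine integral_congr_ae ?_
    filter_upwards [hKf.coeFn_toLp] with x hx
    rw [hx, ← integral_const_mul]
    simp only [mul_left_comm]
  have hu : u =ᵐ[μ] (fun x => ∫ y, k (x, y) * f y ∂ν) ↔ u = hKf.toLp :=
    ⟨fun h => Lp.ext (h.trans hKf.coeFn_toLp.symm), fun h => h ▸ hKf.coeFn_toLp⟩
  simp_rw [hu, ← hinner]
  exact ⟨fun h g => by rw [h], ext_inner_left 𝕜⟩

theorem exists_kernel_of_summable_norm_sq (b : HilbertBasis ι 𝕜 (Lp 𝕜 2 ν))
    (T : Lp 𝕜 2 ν →L[𝕜] Lp 𝕜 2 μ) (hT : Summable fun i => ‖T (b i)‖ ^ 2) :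
    ∃ k : Lp 𝕜 2 (μ.prod ν), ∀ f, T f =ᵐ[μ] fun x => ∫ y, k (x, y) * f y ∂ν := by
  have hsum : Summable fun i => rankOneKernel (T (b i)) (b i) := by
    refine summable_of_pairwise_inner_eq_zero (𝕜 := 𝕜) (fun i j hij => ?_) ?_
    · simp only [inner_rankOneKernel_rankOneKernel, b.orthonormal.2 hij.symm, mul_zero]
    · simpa [norm_rankOneKernel, b.orthonormal.1] using hT
  refine ⟨∑' i, rankOneKernel (T (b i)) (b i), fun f =>
    (ae_eq_integral_mul_iff (Lp.memLp _) f (T f)).2 fun g => ?_⟩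
  rw [← inner_rankOneKernel_left]
  have hkernel := hsum.hasSum.mapL (innerSL 𝕜 (rankOneKernel g f))
  have hoperator := ((b.hasSum_repr f).mapL T).mapL (innerSL 𝕜 g)
  refine hoperator.unique (hkernel.congr_fun fun i => ?_)
  simp [inner_rankOneKernel_rankOneKernel, b.repr_apply_apply, mul_comm]

end IntegralKernel

section HilbertSchmidt

variable {T : L2R →L[ℂ] L2R} {k : ℝ × ℝ → ℂ}

theorem isHSKernel_iff_inner_eq (hk : MemLp k 2 volume) : IsHSKernel T k ↔
    ∀ g f : L2R, inner ℂ g (T f) = ∫ z : ℝ × ℝ, k z * (conj (g z.1) * f z.2) :=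
  ⟨fun h g f => (ae_eq_integral_mul_iff hk f (T f)).1 (h.apply_ae f) g,
    fun h => ⟨hk, fun f => (ae_eq_integral_mul_iff hk f (T f)).2 fun g => h g f⟩⟩

theorem IsHSKernel.hsNormSq_eq_lintegral (hk : IsHSKernel T k) :
    hsNormSq T = ∫⁻ z, ‖k z‖ₑ ^ 2 := by
  have : Fact ((2 : ℝ≥0∞) ≠ ∞) := ⟨ENNReal.ofNat_ne_top⟩
  have : Countable l2Index := countable_of_orthonormal l2Basis.orthonormal
  exact tsum_enorm_sq_eq_lintegral_kernel l2Basis hk.memLp fun i => hk.apply_ae _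

theorem IsHSKernel.isHilbertSchmidt (hk : IsHSKernel T k) : IsHilbertSchmidt T := by
  have := hk.memLp.2
  rw [IsHilbertSchmidt, hk.hsNormSq_eq_lintegral, ← eLpNorm_two_sq]
  finiteness

theorem IsHSKernel.integrable_norm_sq (hk : IsHSKernel T k) :
    Integrable (fun z => ‖k z‖ ^ 2) volume :=
  hk.memLp.integrable_norm_pow two_ne_zero

theorem IsHSKernel.toReal_hsNormSq_eq_integral (hk : IsHSKernel T k) :
    (hsNormSq T).toReal = ∫ z, ‖k z‖ ^ 2 := by
  rw [hk.hsNormSq_eq_lintegral, integral_eq_lintegral_of_nonneg_ae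
    (.of_forall fun z => sq_nonneg ‖k z‖) hk.integrable_norm_sq.1]
  simp_rw [ENNReal.ofReal_pow (norm_nonneg _), ofReal_norm]

theorem IsHSKernel.eq_zero_of_ae_eq_zero (hk : IsHSKernel T k) (h0 : k =ᵐ[volume] 0) :
    T = 0 := by
  ext1 f
  refine ext_inner_left ℂ fun g => ?_
  rw [(isHSKernel_iff_inner_eq hk.memLp).1 hk, zero_apply, inner_zero_right]
  refine integral_eq_zero_of_ae ?_
  filter_upwards [h0] with z hz
  simp [hz]

theorem IsHilbertSchmidt.exists_isHSKernel (hT : IsHilbertSchmidt T) :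
    ∃ k : ℝ × ℝ → ℂ, IsHSKernel T k := by
  have hsum : Summable fun i => ‖T (l2Basis i)‖ ^ 2 := by
    simpa using ENNReal.summable_toReal hT
  obtain ⟨k, hk⟩ := exists_kernel_of_summable_norm_sq l2Basis T hsum
  exact ⟨k, Lp.memLp k, hk⟩

theorem hsNormSq_mul_le (S T : L2R →L[ℂ] L2R) : hsNormSq (S * T) ≤ ‖S‖ₑ ^ 2 * hsNormSq T := by
  rw [hsNormSq, hsNormSq, ← ENNReal.tsum_mul_left]
  refine ENNReal.tsum_le_tsum fun i => ?_
  rw [← mul_pow]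
  gcongr
  exact S.le_opENorm _

theorem posTrace_adjoint_mul_self (S : L2R →L[ℂ] L2R) :
    posTrace (ContinuousLinearMap.adjoint S * S) = hsNormSq S := by
  refine tsum_congr fun i => ?_
  rw [mul_apply_eq_comp, ContinuousLinearMap.adjoint_inner_right,
    inner_self_eq_norm_sq, ENNReal.ofReal_pow (norm_nonneg _), ofReal_norm]

theorem IsNormalState.isHilbertSchmidt {ρ : L2R →L[ℂ] L2R} (hρ : IsNormalState ρ) :
    IsHilbertSchmidt ρ := by
  obtain ⟨S, hS, rfl⟩ := exists_adjoint_eq_self_mul_self ρ hρ.isPositive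
  have hSnorm : hsNormSq S = 1 := by
    rw [← posTrace_adjoint_mul_self, hS, hρ.trace_eq_one]
  refine ne_top_of_le_ne_top ?_ (hsNormSq_mul_le S S)
  rw [hSnorm]
  finiteness

theorem IsNormalState.ne_zero {ρ : L2R →L[ℂ] L2R} (hρ : IsNormalState ρ) : ρ ≠ 0 := by
  rintro rfl
  simpa [posTrace] using hρ.trace_eq_one

end HilbertSchmidt

section Support

variable {X : Type*} [TopologicalSpace X] [MeasurableSpace X] {μ : Measure X}
  [IsProbabilityMeasure μ]

theorem nontrivial_support_of_forall_ne_dirac [HereditarilyLindelofSpace X]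
    (hμ : ∀ x, μ ≠ Measure.dirac x) : μ.support.Nontrivial := by
  obtain ⟨x, hx⟩ := Measure.nonempty_support (IsProbabilityMeasure.ne_zero μ)
  by_contra hsub
  have hae : id =ᵐ[μ] fun _ => x := by
    filter_upwards [Measure.support_mem_ae (μ := μ)] with y hy
    exact Set.not_nontrivial_iff.1 hsub hy hx
  exact hμ x (Measure.map_id.symm.trans (ProbabilityTheory.hasLaw_dirac_of_ae_eq hae).map_eq)

theorem eqOn_support_integral_of_norm_integral_eq {F : Type*} [NormedAddCommGroup F]
    [NormedSpace ℝ F] [CompleteSpace F] [StrictConvexSpace ℝ F] {f : X → F} (hf : Continuous f)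
    {C : ℝ} (hC : ∀ x, ‖f x‖ ≤ C) (heq : ‖∫ x, f x ∂μ‖ = C) :
    Set.EqOn f (fun _ => ∫ x, f x ∂μ) μ.support := by
  have hae : f =ᵐ[μ] fun _ => ∫ x, f x ∂μ := by
    rcases ae_eq_const_or_norm_integral_lt_of_norm_le_const
      (μ := μ) (.of_forall hC) with h | h
    · rwa [average_eq_integral] at h
    · simp [heq] at h
  exact Measure.support_subset_of_isClosed (isClosed_eq hf continuous_const) hae

end Support

theorem countable_setOf_norm_charFun_eq_one {μ : Measure ℝ} [IsProbabilityMeasure μ]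
    (hμ : ∀ p, μ ≠ Measure.dirac p) : {t | ‖charFun μ t‖ = 1}.Countable := by
  obtain ⟨p, hp, q, hq, hpq⟩ := nontrivial_support_of_forall_ne_dirac hμ
  refine (Set.countable_range fun n : ℤ => n * (2 * Real.pi) / (p - q)).mono fun t ht => ?_
  have hconst := eqOn_support_integral_of_norm_integral_eq
    (f := fun x : ℝ => Complex.exp (inner ℝ x t * Complex.I)) (μ := μ) (by fun_prop)
    (fun x => (Complex.norm_exp_ofReal_mul_I _).le) ht
  obtain ⟨n, hn⟩ := Complex.exp_eq_exp_iff_exists_int.1 ((hconst hp).trans (hconst hq).symm)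
  have hphase : p * t = q * t + n * (2 * Real.pi) := by
    simpa [mul_comm t] using congrArg Complex.im hn
  refine ⟨n, (div_eq_iff (sub_ne_zero.2 hpq)).2 ?_⟩
  linarith

section Dephasing

variable (ħ : ℝ) (μ : Measure ℝ) {ρ : L2R →L[ℂ] L2R} {k : ℝ × ℝ → ℂ}

theorem kickPhase_sub (p x y : ℝ) :
    kickPhase ħ p (x - y) = kickPhase ħ p x * kickPhase ħ (-p) y := by
  rw [kickPhase, kickPhase, kickPhase, ← Complex.exp_add]
  congr 1
  push_cast
  ring

theorem IsHSKernel.kick_conj (hk : IsHSKernel ρ k) (p : ℝ) :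
    IsHSKernel (kick ħ p * ρ * kick ħ (-p)) fun z => kickPhase ħ p (z.1 - z.2) * k z := by
  have hphase : Continuous fun z : ℝ × ℝ => kickPhase ħ p (z.1 - z.2) :=
    (continuous_kickPhase ħ p).comp (by fun_prop)
  refine ⟨hk.memLp.of_le (hphase.aestronglyMeasurable.mul hk.memLp.1)
    (.of_forall fun z => by simp [norm_kickPhase]), fun f => ?_⟩
  filter_upwards [coeFn_kick ħ p (ρ (kick ħ (-p) f)), hk.apply_ae (kick ħ (-p) f)]
    with x hkick hρ
  simp only [mul_apply_eq_comp]
  rw [hkick, hρ, ← integral_const_mul]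
  refine integral_congr_ae ?_
  filter_upwards [coeFn_kick ħ (-p) f] with y hy
  rw [hy, kickPhase_sub]
  ring

theorem dephasingKernel_eq_charFun (ξ : ℝ) : dephasingKernel ħ μ ξ = charFun μ (ξ / ħ) := by
  simp only [dephasingKernel, kickPhase, charFun_apply_real]
  congr! 3
  push_cast
  ring

theorem measurable_dephasingKernel [SFinite μ] : Measurable (dephasingKernel ħ μ) := by
  simp_rw [funext (dephasingKernel_eq_charFun ħ μ)]
  exact measurable_charFun.comp (measurable_id.div_const ħ)

theorem integral_integral_kickPhase_mul {X : Type*} [MeasurableSpace X] {ν : Measure X}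
    [SFinite ν] [IsFiniteMeasure μ] {φ : X → ℝ} (hφ : Measurable φ) {F : X → ℂ}
    (hF : Integrable F ν) :
    ∫ p, ∫ x, kickPhase ħ p (φ x) * F x ∂ν ∂μ = ∫ x, dephasingKernel ħ μ (φ x) * F x ∂ν := by
  have hphase : Measurable fun q : ℝ × X => kickPhase ħ q.1 (φ q.2) := by
    unfold kickPhase
    fun_prop
  rw [integral_integral_swap ((hF.comp_snd μ).bdd_mul hphase.aestronglyMeasurable
    (.of_forall fun q => (norm_kickPhase _ _ _).le))]
  simp_rw [integral_mul_const, dephasingKernel]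

variable [IsProbabilityMeasure μ]

theorem norm_dephasingKernel_le_one (ξ : ℝ) : ‖dephasingKernel ħ μ ξ‖ ≤ 1 := by
  rw [dephasingKernel_eq_charFun]
  exact norm_charFun_le_one _

theorem one_sub_norm_dephasingKernel_sq_nonneg (ξ : ℝ) : 0 ≤ 1 - ‖dephasingKernel ħ μ ξ‖ ^ 2 :=
  sub_nonneg.2 (pow_le_one₀ (norm_nonneg _) (norm_dephasingKernel_le_one ħ μ ξ))

theorem IsHSKernel.dephasing (hk : IsHSKernel ρ k) :
    IsHSKernel (dephasing ħ μ ρ) fun z => dephasingKernel ħ μ (z.1 - z.2) * k z := by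
  have hmeas : Measurable fun z : ℝ × ℝ => dephasingKernel ħ μ (z.1 - z.2) :=
    (measurable_dephasingKernel ħ μ).comp (measurable_fst.sub measurable_snd)
  refine (isHSKernel_iff_inner_eq (hk.memLp.of_le (hmeas.aestronglyMeasurable.mul hk.memLp.1)
    (.of_forall fun z => ?_))).2 fun g f => ?_
  · rw [Pi.mul_apply, norm_mul]
    exact mul_le_of_le_one_left (norm_nonneg _) (norm_dephasingKernel_le_one ħ μ _)
  have hconj (p : ℝ) : inner ℂ g (kick ħ p (ρ (kick ħ (-p) f))) =
      ∫ z : ℝ × ℝ, kickPhase ħ p (z.1 - z.2) * (k z * (conj (g z.1) * f z.2)) := by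
    have hk_conj := hk.kick_conj ħ p
    simpa only [mul_apply_eq_comp, mul_assoc] using
      (isHSKernel_iff_inner_eq hk_conj.memLp).1 hk_conj g f
  calc inner ℂ g (∫ p, kick ħ p (ρ (kick ħ (-p) f)) ∂μ)
      = ∫ p, inner ℂ g (kick ħ p (ρ (kick ħ (-p) f))) ∂μ :=
        (integral_inner (integrable_kick_conj ħ μ ρ f) g).symm
    _ = ∫ z : ℝ × ℝ, dephasingKernel ħ μ (z.1 - z.2) * (k z * (conj (g z.1) * f z.2)) := by
        simp_rw [hconj]
        exact integral_integral_kickPhase_mul ħ μ (measurable_fst.sub measurable_snd)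
          (integrable_kernel_mul hk.memLp g f)
    _ = ∫ z : ℝ × ℝ, dephasingKernel ħ μ (z.1 - z.2) * k z * (conj (g z.1) * f z.2) := by
        simp only [mul_assoc]

theorem IsHSKernel.integrable_and_l2DephasingLoss_eq_integral (hk : IsHSKernel ρ k) :
    Integrable (fun z : ℝ × ℝ =>
        (1 - ‖dephasingKernel ħ μ (z.1 - z.2)‖ ^ 2) * ‖k z‖ ^ 2) volume ∧
      l2DephasingLoss ħ μ ρ =
        ∫ z : ℝ × ℝ, (1 - ‖dephasingKernel ħ μ (z.1 - z.2)‖ ^ 2) * ‖k z‖ ^ 2 := by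
  have hdeph := hk.dephasing ħ μ
  simp_rw [sub_mul, one_mul, ← mul_pow, ← norm_mul]
  refine ⟨hk.integrable_norm_sq.sub hdeph.integrable_norm_sq, ?_⟩
  rw [l2DephasingLoss, hk.toReal_hsNormSq_eq_integral, hdeph.toReal_hsNormSq_eq_integral,
    integral_sub hk.integrable_norm_sq hdeph.integrable_norm_sq]

theorem IsHilbertSchmidt.l2DephasingLoss_nonneg (hρ : IsHilbertSchmidt ρ) :
    0 ≤ l2DephasingLoss ħ μ ρ := by
  obtain ⟨k, hk⟩ := hρ.exists_isHSKernel
  rw [(hk.integrable_and_l2DephasingLoss_eq_integral ħ μ).2]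
  exact integral_nonneg fun z =>
    mul_nonneg (one_sub_norm_dephasingKernel_sq_nonneg ħ μ _) (sq_nonneg _)

theorem dephasing_zero : dephasing ħ μ 0 = 0 := by
  ext1 f
  change ∫ p, kick ħ p ((0 : L2R →L[ℂ] L2R) (kick ħ (-p) f)) ∂μ = 0
  simp

theorem dephasing_dirac_zero (ρ : L2R →L[ℂ] L2R) : dephasing ħ (Measure.dirac 0) ρ = ρ := by
  have hkick (f : L2R) : kick ħ 0 f = f := by
    refine Lp.ext ?_
    filter_upwards [coeFn_kick ħ 0 f] with x hx
    simp [hx, kickPhase]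
  ext1 f
  change ∫ p, kick ħ p (ρ (kick ħ (-p) f)) ∂Measure.dirac 0 = ρ f
  rw [integral_dirac, neg_zero, hkick, hkick]

variable {ħ μ}

theorem l2DephasingLoss_eq_zero_of_dephasing_eq_self (h : dephasing ħ μ ρ = ρ) :
    l2DephasingLoss ħ μ ρ = 0 := by
  rw [l2DephasingLoss, h, sub_self]

theorem ae_norm_dephasingKernel_ne_one (hħ : ħ ≠ 0) (hμ : ∀ p, μ ≠ Measure.dirac p) :
    ∀ᵐ ξ, ‖dephasingKernel ħ μ ξ‖ ≠ 1 := by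
  simp_rw [dephasingKernel_eq_charFun]
  exact ((countable_setOf_norm_charFun_eq_one hμ).preimage
    fun _ _ => (div_left_inj' hħ).1).ae_notMem volume

theorem IsHilbertSchmidt.l2DephasingLoss_eq_zero_iff (hρ : IsHilbertSchmidt ρ)
    (hg : ∀ᵐ ξ, ‖dephasingKernel ħ μ ξ‖ ≠ 1) : l2DephasingLoss ħ μ ρ = 0 ↔ ρ = 0 := by
  refine ⟨fun hloss => ?_, fun h => l2DephasingLoss_eq_zero_of_dephasing_eq_self ?_⟩
  · obtain ⟨k, hk⟩ := hρ.exists_isHSKernel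
    obtain ⟨hint, hformula⟩ := hk.integrable_and_l2DephasingLoss_eq_integral ħ μ
    have hintegrand := (integral_eq_zero_iff_of_nonneg (fun z => mul_nonneg
      (one_sub_norm_dephasingKernel_sq_nonneg ħ μ _) (sq_nonneg _)) hint).1
        (hformula.symm.trans hloss)
    have hg_diff : ∀ᵐ z : ℝ × ℝ, ‖dephasingKernel ħ μ (z.1 - z.2)‖ ≠ 1 :=
      (quasiMeasurePreserving_sub volume volume).ae hg
    refine hk.eq_zero_of_ae_eq_zero ?_
    filter_upwards [hintegrand, hg_diff] with z hz hgz
    have hne : 1 - ‖dephasingKernel ħ μ (z.1 - z.2)‖ ^ 2 ≠ 0 := fun h =>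
      hgz ((pow_eq_one_iff_of_nonneg (norm_nonneg _) two_ne_zero).1 (sub_eq_zero.1 h).symm)
    simpa [hne] using hz
  · rw [h, dephasing_zero]

theorem IsHilbertSchmidt.l2DephasingLoss_pos (hρ : IsHilbertSchmidt ρ)
    (hg : ∀ᵐ ξ, ‖dephasingKernel ħ μ ξ‖ ≠ 1) (hρ₀ : ρ ≠ 0) : 0 < l2DephasingLoss ħ μ ρ :=
  (hρ.l2DephasingLoss_nonneg ħ μ).lt_of_ne' (mt (hρ.l2DephasingLoss_eq_zero_iff hg).1 hρ₀)

theorem IsHilbertSchmidt.l2DephasingLoss_eq_zero_iff_dephasing_eq_self (hρ : IsHilbertSchmidt ρ)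
    (hħ : ħ ≠ 0) (hμ : ∀ p, p ≠ 0 → μ ≠ Measure.dirac p) :
    l2DephasingLoss ħ μ ρ = 0 ↔ dephasing ħ μ ρ = ρ := by
  refine ⟨fun hloss => ?_, l2DephasingLoss_eq_zero_of_dephasing_eq_self⟩
  by_cases hμ₀ : μ = Measure.dirac 0
  · subst hμ₀
    exact dephasing_dirac_zero ħ ρ
  · have hdirac (p : ℝ) : μ ≠ Measure.dirac p := by
      rcases eq_or_ne p 0 with rfl | hp
      exacts [hμ₀, hμ p hp]
    rw [(hρ.l2DephasingLoss_eq_zero_iff (ae_norm_dephasingKernel_ne_one hħ hdirac)).1 hloss,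
      dephasing_zero]

end Dephasing

theorem mainTheorem8 (ħ : ℝ) (hħ : 0 < ħ) (μ : Measure ℝ) [IsProbabilityMeasure μ] :
    -- all quantities are well defined: states are Hilbert-Schmidt, Hilbert-Schmidt operators have
    -- a position kernel, and dephasing preserves the Hilbert-Schmidt class
    (∀ ρ : L2R →L[ℂ] L2R, IsNormalState ρ → IsHilbertSchmidt ρ) ∧
    (∀ ρ : L2R →L[ℂ] L2R, IsHilbertSchmidt ρ →
      IsHilbertSchmidt (dephasing ħ μ ρ) ∧ ∃ k : ℝ × ℝ → ℂ, IsHSKernel ρ k) ∧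
    -- the integral formula
    (∀ ρ : L2R →L[ℂ] L2R, IsHilbertSchmidt ρ → ∀ k : ℝ × ℝ → ℂ, IsHSKernel ρ k →
      Integrable (fun z : ℝ × ℝ =>
        (1 - ‖dephasingKernel ħ μ (z.1 - z.2)‖ ^ 2) * ‖k z‖ ^ 2) volume ∧
      l2DephasingLoss ħ μ ρ =
        ∫ z : ℝ × ℝ, (1 - ‖dephasingKernel ħ μ (z.1 - z.2)‖ ^ 2) * ‖k z‖ ^ 2) ∧
    -- faithfulness, unless the kick is deterministic and nonzero
    ((∀ p : ℝ, p ≠ 0 → μ ≠ Measure.dirac p) → ∀ ρ : L2R →L[ℂ] L2R, IsHilbertSchmidt ρ →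
      (l2DephasingLoss ħ μ ρ = 0 ↔ dephasing ħ μ ρ = ρ)) ∧
    -- strict positivity on normal states
    ((∀ ξ : ℝ, ξ ≠ 0 → ‖dephasingKernel ħ μ ξ‖ < 1) → ∀ ρ : L2R →L[ℂ] L2R, IsNormalState ρ →
      0 < l2DephasingLoss ħ μ ρ) := by
  refine ⟨fun ρ hρ => hρ.isHilbertSchmidt, fun ρ hρ => ?_,
    fun ρ _ k hk => hk.integrable_and_l2DephasingLoss_eq_integral ħ μ,
    fun hμ ρ hρ => hρ.l2DephasingLoss_eq_zero_iff_dephasing_eq_self hħ.ne' hμ, fun hg ρ hρ => ?_⟩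
  · obtain ⟨k, hk⟩ := hρ.exists_isHSKernel
    exact ⟨(hk.dephasing ħ μ).isHilbertSchmidt, k, hk⟩
  · refine hρ.isHilbertSchmidt.l2DephasingLoss_pos ?_ hρ.ne_zero
    filter_upwards [Measure.ae_ne volume 0] with ξ hξ using (hg ξ hξ).ne
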